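/- Let $0<\alpha<1$, $\beta>0$, $\mu>0$, $\sigma\ge 0$. A generalized process on $(0,\infty)$ is a continuous linear map $Y:L^2(0,\infty)\to L^2(\Omega,P)$, written $Y(\psi)=\int_0^\infty\psi(t)Y(t)\,dt$; for $z\ge0$ the translate $t\mapsto Y(t+z)$ is $\psi\mapsto Y(\tau_z\psi)$, with $\tau_z\psi(t)=\psi(t-z)\mathbf 1_{\{t>z\}}$. Let $\mathcal E$ be a Gaussian white noise on $(0,\infty)$ of intensity $\sigma^2$, i.e. a generalized process such that each $\mathcal E(\psi)$ is $N(0,\sigma^2\|\psi\|^2)$-distributed. For $s>0$ let $h_\alpha(\cdot,s)$ be the probability density on $(0,\infty)$ (jointly measurable in both variables) with $\int_0^\infty e^{-\xi z}h_\alpha(z,s)\,dz=e^{-s\xi^\alpha}$, $\xi\ge0$. The upper fractional derivative is $$\frac{d^\alpha}{d(-t)^\alpha}f(t)=\frac{\alpha}{\Gamma(1-\alpha)}\int_0^\infty\frac{f(t)-f(t+w)}{w^{\alpha+1}}\,dw ,$$ and its transpose $D$ acts in $L^2(0,\infty)$ by $$D\varphi=\frac{\alpha}{\Gamma(1-\alpha)}\lim_{\varepsilon\downarrow0}\int_\varepsilon^\infty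 \frac{\varphi-\tau_w\varphi}{w^{\alpha+1}}\,dw\quad(\text{limit in }L^2),$$ with domain the set of $\varphi$ for which the limit exists. Let $B=(\mu+D)^\beta$, the fractional power being the inverse of the operator $$(\mu+D)^{-\beta}\psi=\frac{\Gamma(n)}{\Gamma(\beta)\Gamma(n-\beta)}\int_0^\infty\lambda^{n-\beta-1}(\lambda+\mu+D)^{-n}\psi\,d\lambda,\qquad n=\lfloor\beta\rfloor+1 .$$ A generalized process $X$ is called a solution of $$\Big(\mu+\frac{d^\alpha}{d(-t)^\alpha}\Big)^\beta X(t)=\mathcal E(t),\qquad t>0,$$ if $C_c^\infty(0,\infty)\subset\mathrm{Dom}(B)$ and $X(B\varphi)=\mathcal E(\varphi)$ almost surely for every $\varphi\in \mathrm{Dom}(B)$. **Theorem.** The formula $$X(t)=\frac1{\Gamma(\beta)}\int_0^\infty dz\int_0^\infty ds\; s^{\beta-1}e^{-s\mu}\,h_\alpha(z,s)\,\mathcal E(t+z),$$ that is, $X(\psi)=\Gamma(\beta)^{-1}\int_0^\infty\int_0^\infty s^{\beta-1}e^{-s\mu}h_\alpha(z,s)\,\mathcal E(\tau_z\psi)\,ds\,dz$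 for $\psi\in L^2(0,\infty)$ (the integrand being Bochner integrable on $(0,\infty)^2$ with values in $L^2(\Omega,P)$), defines a generalized process $X$ which is a solution of this equation. Moreover, let $H^\alpha$ be a stable subordinator of order $\alpha$, $\mathbb E e^{-\xi H^\alpha(s)}=e^{-s\xi^\alpha}$, and $W_\beta$ a random variable independent of $H^\alpha$ with the gamma law of shape $\beta$ and rate $\mu$. Then $$X(t)=\mu^{-\beta}\,\mathbb E\,\mathcal E\big(t+H^\alpha(W_\beta)\big),$$ the expectation being taken with respect to $H^\alpha(W_\beta)$ only; that is, $\mathcal E(\tau_{H^\alpha(W_\beta)}\psi)$ is Bochner integrable and $X(\psi)=\mu^{-\beta}\,\mathbb E[\mathcal E(\tau_{H^\alpha(W_\beta)}\psi)]$ for all $\psi\in L^2(0,\infty)$. -/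

import Mathlib

open MeasureTheory ProbabilityTheory Filter Topology Set
open scoped NNReal

noncomputable section

/-! ### Time axis, shifts and generalized processes -/

/-- The space `L²(0, ∞)` of (test) functions on the time axis `t > 0`. -/
abbrev TimeL2 : Type := Lp ℝ 2 ((volume : Measure ℝ).restrict (Ioi 0))

/-- The translate `t ↦ f (t - z)` of a function on `(0, ∞)`, extended by zero to `t ≤ z`. -/
def shiftFun (z : ℝ) (f : ℝ → ℝ) : ℝ → ℝ := (Ioi z).indicator fun t => f (t - z)

lemma memLp_shiftFun (z : ℝ) (f : TimeL2) :
    MemLp (shiftFun z f) 2 ((volume : Measure ℝ).restrict (Ioi 0)) := by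
  unfold shiftFun
  rw [memLp_indicator_iff_restrict measurableSet_Ioi, Measure.restrict_restrict measurableSet_Ioi]
  have hmp : MeasurePreserving (fun t : ℝ => t - z)
      (volume.restrict ((fun t : ℝ => t - z) ⁻¹' Ioi 0)) (volume.restrict (Ioi 0)) :=
    (measurePreserving_sub_right volume z).restrict_preimage measurableSet_Ioi
  have h := (Lp.memLp f).comp_measurePreserving hmp
  refine h.mono_measure (Measure.restrict_mono ?_ le_rfl)
  intro t ht
  have h1 : z < t := ht.1
  simpa using h1

/-- The translation `f ↦ f (· - z)` on `L²(0, ∞)` (zero extension); used for `z ≥ 0`. -/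
def shift (z : ℝ) (f : TimeL2) : TimeL2 := (memLp_shiftFun z f).toLp _

/-- A (mean square) generalized random process on `(0, ∞)`: a continuous linear map `Y` from
`L²(0, ∞)` to `L²(Ω, P)`, where `Y ψ` stands for `∫ ψ(t) Y(t) dt`. In particular, for `z ≥ 0`,
the translated process `t ↦ Y(t + z)` is `ψ ↦ Y (shift z ψ)`, because
`∫ ψ(t) Y(t + z) dt = ∫ ψ(t - z) Y(t) dt`. -/
abbrev GeneralizedProcess {Ω : Type*} [MeasurableSpace Ω] (P : Measure Ω) : Type _ :=
  TimeL2 →L[ℝ] Lp ℝ 2 P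

/-- Gaussian white noise on `(0, ∞)` of intensity `σ²`: every `ℰ f` is a centered normal variable
of variance `σ² ‖f‖²`. By linearity the family `(ℰ f)` is then jointly Gaussian, and
`𝔼 (ℰ f)(ℰ g) = σ² ∫ f g`. -/
def IsGaussianWhiteNoise {Ω : Type*} [MeasurableSpace Ω] {P : Measure Ω} (σ : ℝ≥0)
    (ℰ : GeneralizedProcess P) : Prop :=
  ∀ f : TimeL2, HasLaw (ℰ f) (gaussianReal 0 (σ ^ 2 * ‖f‖₊ ^ 2)) P

/-! ### The fractional derivative -/

/-- `HasLowerMarchaud α f g`: the function `f ∈ L²(0, ∞)` has the Marchaud derivative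
`g(t) = α / Γ(1 - α) ∫_0^∞ (f(t) - f(t - w)) / w^(α + 1) dw`
(with `f = 0` on the negative axis), where, as usual, the singular integral is the limit in `L²`
of the truncated integrals over `w > ε` as `ε ↓ 0`.

This is the transpose of the upper derivative
`d^α/d(-t)^α X(t) = α / Γ(1 - α) ∫_0^∞ (X(t) - X(t + w)) / w^(α + 1) dw`,
because `X (f - shift w f)` is the pairing of `t ↦ X(t) - X(t + w)` with `f`. -/
def HasLowerMarchaud (α : ℝ) (f g : TimeL2) : Prop :=
  Tendsto (fun ε : ℝ => (α / Real.Gamma (1 - α)) •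
      ∫ w in Ioi ε, (w ^ (-(α + 1)) : ℝ) • (f - shift w f)) (𝓝[>] 0) (𝓝 g)

/-- The graph of the operator `μ + D`, `D` the Marchaud derivative of `HasLowerMarchaud`:
`(μ + D) f = g`. -/
def shiftedMarchaud (α μ : ℝ) (f g : TimeL2) : Prop :=
  HasLowerMarchaud α f (g - μ • f)

/-! ### Fractional powers of an operator -/

section FracPow

variable {E : Type*} [NormedAddCommGroup E] [NormedSpace ℝ E]

/-- The graph of the `n`-th power of the (unbounded) operator with graph `T`. -/
def IterGraph (T : E → E → Prop) : ℕ → E → E → Prop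
  | 0, x, y => x = y
  | n + 1, x, y => ∃ u, T x u ∧ IterGraph T n u y

/-- The graph of `l + T`. -/
def addScalarGraph (T : E → E → Prop) (l : ℝ) (x y : E) : Prop := T x (y - l • x)

/-- `FracPow T β φ ψ` means `T^β φ = ψ`, for `β > 0` and an operator `T` with a bounded inverse,
given by its graph, whose resolvent set contains `(-∞, 0]`. As usual, `T^β` is the inverse of the
operator `T^(-β)`, which is given by the Balakrishnan-Komatsu resolvent integral
`T^(-β) ψ = Γ(n) / (Γ(β) Γ(n - β)) ∫_0^∞ l^(n - β - 1) (l + T)^(-n) ψ dl`, `n = ⌊β⌋ + 1`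
(for `0 < β < 1` this is `sin(π β) / π ∫_0^∞ l^(-β) (l + T)^(-1) ψ dl`).
Here `r l` is `(l + T)^(-n) ψ`, that is `(l + T)^n (r l) = ψ`. -/
def FracPow (T : E → E → Prop) (β : ℝ) (φ ψ : E) : Prop :=
  ∃ r : ℝ → E,
    (∀ l : ℝ, 0 < l → IterGraph (addScalarGraph T l) (⌊β⌋₊ + 1) (r l) ψ) ∧
    IntegrableOn (fun l : ℝ => (l ^ (((⌊β⌋₊ + 1 : ℕ) : ℝ) - β - 1) : ℝ) • r l) (Ioi 0) ∧
    φ = (Real.Gamma ((⌊β⌋₊ + 1 : ℕ) : ℝ) /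
          (Real.Gamma β * Real.Gamma (((⌊β⌋₊ + 1 : ℕ) : ℝ) - β))) •
        ∫ l in Ioi (0 : ℝ), (l ^ (((⌊β⌋₊ + 1 : ℕ) : ℝ) - β - 1) : ℝ) • r l

end FracPow

/-! ### The equation -/

/-- The generalized process `X` is a solution of `(μ + d^α/d(-t)^α)^β X = ℰ` on `(0, ∞)`, in the
weak sense: with `B = (μ + D)^β`, where `D` is the transpose of `d^α/d(-t)^α`, the domain of `B`
contains all smooth test functions with compact support in `(0, ∞)`, and `X (B φ) = ℰ φ` holds
(almost surely) for each `φ` in the domain of `B`. -/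
structure IsWeakSolution {Ω : Type*} [MeasurableSpace Ω] {P : Measure Ω} (α β μ : ℝ)
    (X ℰ : GeneralizedProcess P) : Prop where
  test_mem_domain : ∀ u : ℝ → ℝ, ContDiff ℝ ((⊤ : ℕ∞) : WithTop ℕ∞) u → HasCompactSupport u → tsupport u ⊆ Ioi 0 →
    ∀ hu : MemLp u 2 ((volume : Measure ℝ).restrict (Ioi 0)),
      ∃ ψ : TimeL2, FracPow (shiftedMarchaud α μ) β (hu.toLp u) ψ
  eqn : ∀ φ ψ : TimeL2, FracPow (shiftedMarchaud α μ) β φ ψ → X ψ = ℰ φ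

/-! ### The stable subordinator -/

/-- `h z s` (`z, s > 0`) is (a jointly measurable version of) the probability density in `z` of the
positively skewed stable law of order `α` at time `s`, the law on `(0, ∞)` with Laplace transform
`∫_0^∞ e^(-ξ z) h(z, s) dz = e^(-s ξ^α)`, `ξ ≥ 0` (so `h(·, s)` is unique up to null sets). -/
structure IsStableDensity (α : ℝ) (h : ℝ → ℝ → ℝ) : Prop where
  measurable : Measurable (Function.uncurry h)
  nonneg : ∀ z s, 0 < z → 0 < s → 0 ≤ h z s
  laplace : ∀ s ξ : ℝ, 0 < s → 0 ≤ ξ →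
    ∫ z in Ioi (0 : ℝ), Real.exp (-(ξ * z)) * h z s = Real.exp (-(s * ξ ^ α))

/-- `H` is a stable subordinator of order `α`: an increasing right-continuous process with
independent stationary increments, started at `0`, and `𝔼 e^(-ξ H(s)) = e^(-s ξ^α)`. -/
structure IsStableSubordinator {Ω : Type*} [MeasurableSpace Ω] (P : Measure Ω) (α : ℝ)
    (H : ℝ≥0 → Ω → ℝ) : Prop where
  measurable : ∀ s, Measurable (H s)
  zero : ∀ ω, H 0 ω = 0
  mono : ∀ ω, Monotone fun s => H s ω
  rightCts : ∀ ω s, ContinuousWithinAt (fun r => H r ω) (Ici s) s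
  indep : HasIndepIncrements H P
  stationary : ∀ s t, IdentDistrib (fun ω => H (s + t) ω - H s ω) (H t) P P
  laplace : ∀ (s : ℝ≥0) (ξ : ℝ), 0 ≤ ξ →
    ∫ ω, Real.exp (-(ξ * H s ω)) ∂P = Real.exp (-((s : ℝ) * ξ ^ α))

end

/-!
Everything is read off from Laplace transforms. For `ξ > 0` the transform `f ↦ ∫ e^(-ξ t) f(t) dt` is
a continuous functional on `L²(0, ∞)`, these functionals separate points
(`eq_zero_of_laplace_eq_zero`), and the translation by `z ≥ 0` becomes multiplication by `e^(-ξ z)`.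
Hence a superposition of translates is known once its multiplier, a scalar function of `ξ`, is known,
and two such superpositions are compared through scalar integrals.

The Marchaud derivative `D` is exactly the multiplier `ξ^α` (`hasLowerMarchaud_iff`). Passing to the
limit in the truncated integrals gives one direction. For the other, if `g` has transform `ξ^α` times
that of `f`, the truncated integral of `f` is the convolution of `g` with the rescaled probability
density `(t_+^α - (t - 1)_+^α) / (Γ(α) Γ(1 - α) t)`, which converges to `g` because translation is
strongly continuous.

By `∫ e^(-ξ z) h(z, s) dz = e^(-s ξ^α)`, convolution with
`Γ(b)⁻¹ ∫ s^(b - 1) e^(-s l) h(·, s) ds` has the multiplier `(l + ξ^α)^(-b)`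
(`laplace_conv_stableKernel`). With `b = n` this supplies the resolvent powers `(l + μ + D)^(-n)`, and
a Beta integral in `l` identifies the fractional power `(μ + D)^β` with the multiplier
`(μ + ξ^α)^β` on its maximal domain (`fracPow_iff`). With `b = β` it is the operator `R` for which
`X = ℰ ∘ R`, so that `φ = R ψ` whenever `(μ + D)^β φ = ψ`, and `X ψ = ℰ φ`. A test function `u` lies
in the domain because `(μ + D)^n u` exists for every `n` (`exists_laplace_eq_pow_mul`) and
`(μ + D)^β u` is the image of it under `(μ + D)^(-(n - β))`.

Finally `𝔼 e^(-ξ H(W)) = 𝔼 e^(-ξ^α W) = μ^β (μ + ξ^α)^(-β)` for the independent gamma time `W`, so the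
mean of the translates by `H(W)` is `μ^β R`.
-/

noncomputable section

/-! ### The Laplace transform on `L²(0, ∞)` -/

lemma memLp_exp_neg_mul {ξ : ℝ} (hξ : 0 < ξ) :
    MemLp (fun t : ℝ => Real.exp (-(ξ * t))) 2 (volume.restrict (Ioi 0)) := by
  refine (memLp_two_iff_integrable_sq (by fun_prop)).2 ?_
  have h := exp_neg_integrableOn_Ioi 0 (b := 2 * ξ) (by positivity)
  refine h.congr (ae_of_all _ fun t => ?_)
  simp only [sq, ← Real.exp_add]
  congr 1
  ring

/-- The Laplace transform `f ↦ ∫_0^∞ e^(-ξ t) f(t) dt` at the point `ξ > 0`, as a continuous linear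
functional on `L²(0, ∞)`. -/
def laplace (ξ : Ioi (0 : ℝ)) : TimeL2 →L[ℝ] ℝ :=
  innerSL ℝ ((memLp_exp_neg_mul ξ.2).toLp _)

lemma laplace_apply (ξ : Ioi (0 : ℝ)) (f : TimeL2) :
    laplace ξ f = ∫ t in Ioi (0 : ℝ), Real.exp (-(ξ * t)) * f t := by
  rw [laplace, innerSL_apply_apply, L2.inner_def]
  refine integral_congr_ae ?_
  filter_upwards [(memLp_exp_neg_mul ξ.2).coeFn_toLp] with t ht
  rw [ht]
  simp only [RCLike.inner_apply, conj_trivial, mul_comm]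

lemma integrable_exp_mul {ξ : ℝ} (hξ : 0 < ξ) (f : TimeL2) :
    Integrable (fun t => Real.exp (-(ξ * t)) * f t) (volume.restrict (Ioi 0)) :=
  (memLp_exp_neg_mul hξ).integrable_mul (Lp.memLp f)

lemma laplace_toLp (ξ : Ioi (0 : ℝ)) {u : ℝ → ℝ} (hu : MemLp u 2 (volume.restrict (Ioi 0))) :
    laplace ξ (hu.toLp u) = ∫ t in Ioi (0 : ℝ), Real.exp (-(ξ * t)) * u t := by
  rw [laplace_apply]
  refine integral_congr_ae ?_
  filter_upwards [hu.coeFn_toLp] with t ht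
  rw [ht]

/-- The Laplace transform turns the translation by `z` into multiplication by `e^(-ξ z)`. -/
lemma laplace_shift (ξ : Ioi (0 : ℝ)) {z : ℝ} (hz : 0 ≤ z) (f : TimeL2) :
    laplace ξ (shift z f) = Real.exp (-(ξ * z)) * laplace ξ f := by
  rw [shift, laplace_toLp, laplace_apply, ← integral_const_mul,
    ← integral_indicator measurableSet_Ioi, ← integral_indicator measurableSet_Ioi,
    ← integral_sub_right_eq_self
      ((Ioi 0).indicator fun t => Real.exp (-(ξ * z)) * (Real.exp (-(ξ * t)) * f t)) z]
  refine integral_congr_ae (ae_of_all _ fun t => ?_)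
  simp only [shiftFun, indicator, mem_Ioi, sub_pos]
  by_cases h : z < t
  · have h0 : 0 < t := hz.trans_lt h
    simp only [h, h0, if_true, ← mul_assoc, ← Real.exp_add]
    congr 2
    ring
  · simp [h]

/-- The Laplace transform is injective: if `∫ e^(-ξ t) f(t) dt = 0` for all `ξ > 0`, then `f` is
orthogonal to `e^(-t) p(e^(-t))` for every polynomial `p`, and by the Weierstrass theorem to every
test function. -/
lemma eq_zero_of_laplace_eq_zero {f : TimeL2} (hf : ∀ ξ, laplace ξ f = 0) : f = 0 := by
  set g : ℝ → ℝ := fun t => Real.exp (-(1 * t)) * f t with hg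
  have hgi : IntegrableOn g (Ioi 0) := integrable_exp_mul one_pos f
  have hpow : ∀ n : ℕ, ∫ t in Ioi (0 : ℝ), Real.exp (-t) ^ n * g t = 0 := fun n => by
    have h := hf ⟨(n : ℝ) + 1, mem_Ioi.2 n.cast_add_one_pos⟩
    rw [laplace_apply] at h
    refine Eq.trans ?_ h
    refine integral_congr_ae (ae_of_all _ fun t => ?_)
    simp only [hg, ← Real.exp_nat_mul, ← mul_assoc, ← Real.exp_add]
    congr 2
    ring
  have hpi : ∀ n : ℕ, IntegrableOn (fun t => Real.exp (-t) ^ n * g t) (Ioi 0) := fun n => by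
    refine hgi.bdd_mul (c := 1) (by fun_prop) ?_
    filter_upwards [ae_restrict_mem measurableSet_Ioi] with t ht
    rw [norm_pow, Real.norm_eq_abs, Real.abs_exp]
    exact pow_le_one₀ (Real.exp_pos _).le (Real.exp_le_one_iff.2 (neg_nonpos.2 (le_of_lt ht)))
  have hpoly : ∀ p : Polynomial ℝ, IntegrableOn (fun t => p.eval (Real.exp (-t)) * g t) (Ioi 0) ∧
      ∫ t in Ioi (0 : ℝ), p.eval (Real.exp (-t)) * g t = 0 := fun p => by
    induction p using Polynomial.induction_on' with
    | add p q hp hq =>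
      simp only [Polynomial.eval_add, add_mul]
      exact ⟨hp.1.add hq.1, by rw [integral_add hp.1 hq.1, hp.2, hq.2, add_zero]⟩
    | monomial n a =>
      simp only [Polynomial.eval_monomial, mul_assoc]
      exact ⟨(hpi n).const_mul a, by rw [integral_const_mul, hpow, mul_zero]⟩
  have htest : ∀ φ : ℝ → ℝ, Continuous φ → HasCompactSupport φ → tsupport φ ⊆ Ioi 0 →
      ∫ t in Ioi (0 : ℝ), φ t * g t = 0 := fun φ hφ hφc hφs => by
    have hφ0 : φ 0 = 0 := image_eq_zero_of_notMem_tsupport fun h =>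
      lt_irrefl (0 : ℝ) (mem_Ioi.1 (hφs h))
    -- `φ (-log x)` extends continuously by `0` to `x = 0`, where `log` has the value `0`.
    have hcont : Continuous fun x => φ (-Real.log x) := by
      rw [continuous_iff_continuousAt]
      intro x
      rcases eq_or_ne x 0 with rfl | hx
      · rw [continuousAt_iff_punctured_nhds]
        simp only [Real.log_zero, neg_zero, hφ0]
        have h1 : Tendsto (fun x => -Real.log x) (𝓝[≠] 0) atTop :=
          tendsto_neg_atBot_atTop.comp Real.tendsto_log_nhdsNE_zero
        exact (hφc.is_zero_at_infty).comp (h1.mono_right atTop_le_cocompact)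
      · exact hφ.continuousAt.comp (Real.continuousAt_log hx).neg
    refine eq_of_forall_dist_le fun ε hε => ?_
    set M := ∫ t in Ioi (0 : ℝ), ‖g t‖ with hM
    have hM0 : 0 ≤ M := integral_nonneg fun _ => norm_nonneg _
    obtain ⟨p, hp⟩ := exists_polynomial_near_of_continuousOn 0 1 _ hcont.continuousOn (ε / (M + 1))
      (by positivity)
    have hφi : IntegrableOn (fun t => φ t * g t) (Ioi 0) := by
      obtain ⟨C, hC⟩ := hφ.bounded_above_of_compact_support hφc
      exact hgi.bdd_mul hφ.aestronglyMeasurable (ae_of_all _ hC)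
    have hsub := integral_sub hφi (hpoly p).1
    rw [(hpoly p).2, sub_zero] at hsub
    rw [dist_zero_right, ← hsub]
    calc _ ≤ ∫ t in Ioi (0 : ℝ), ε / (M + 1) * ‖g t‖ := by
          refine norm_integral_le_of_norm_le (hgi.norm.const_mul _) ?_
          filter_upwards [ae_restrict_mem measurableSet_Ioi] with t ht
          have h := hp (Real.exp (-t)) ⟨(Real.exp_pos _).le,
            Real.exp_le_one_iff.2 (neg_nonpos.2 (le_of_lt ht))⟩
          rw [Real.log_exp, neg_neg, abs_sub_comm] at h
          rw [← sub_mul, norm_mul]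
          exact mul_le_mul_of_nonneg_right h.le (norm_nonneg _)
      _ = ε / (M + 1) * M := integral_const_mul _ _
      _ ≤ ε := by
          rw [div_mul_eq_mul_div, div_le_iff₀ (by positivity)]
          nlinarith
  have hae : ∀ᵐ t, t ∈ Ioi (0 : ℝ) → g t = 0 := by
    refine isOpen_Ioi.ae_eq_zero_of_integral_contDiff_smul_eq_zero
      hgi.locallyIntegrableOn fun φ hφ hφc hφs => ?_
    refine Eq.trans ?_ (htest φ hφ.continuous hφc hφs)
    rw [setIntegral_eq_integral_of_forall_compl_eq_zero]
    · rfl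
    · intro t ht
      rw [image_eq_zero_of_notMem_tsupport fun h => ht (hφs h), zero_mul]
  rw [Lp.eq_zero_iff_ae_eq_zero]
  filter_upwards [(ae_restrict_iff' measurableSet_Ioi).2 hae] with t ht
  simpa [hg] using ht

lemma laplace_ext {f g : TimeL2} (h : ∀ ξ, laplace ξ f = laplace ξ g) : f = g :=
  sub_eq_zero.1 <| eq_zero_of_laplace_eq_zero fun ξ => by rw [map_sub, h, sub_self]

/-! ### The translation semigroup -/

lemma shift_zero (f : TimeL2) : shift 0 f = f :=
  laplace_ext fun ξ => by simp [laplace_shift ξ le_rfl]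

/-- Translating `f` amounts to translating its extension by zero to the whole line. -/
lemma shift_eq_restrict (z : ℝ) (f : TimeL2) :
    shift z f = LpToLpRestrictCLM ℝ ℝ ℝ volume 2 (Ioi 0)
      (Lp.compMeasurePreserving (fun t : ℝ => t - z) (measurePreserving_sub_right volume z)
        (((memLp_indicator_iff_restrict measurableSet_Ioi).2 (Lp.memLp f)).toLp _)) := by
  refine Lp.ext ?_
  refine (memLp_shiftFun z f).coeFn_toLp.trans ?_
  refine EventuallyEq.trans ?_ (LpToLpRestrictCLM_coeFn ℝ (Ioi 0) _).symm
  refine EventuallyEq.trans ?_ (EventuallyEq.symm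
    (ae_restrict_of_ae (Lp.coeFn_compMeasurePreserving _ (measurePreserving_sub_right volume z))))
  have h := (measurePreserving_sub_right volume z).quasiMeasurePreserving.ae_eq_comp
    ((memLp_indicator_iff_restrict measurableSet_Ioi).2 (Lp.memLp f)).coeFn_toLp
  refine EventuallyEq.trans ?_ (EventuallyEq.symm (ae_restrict_of_ae h))
  refine ae_of_all _ fun t => ?_
  simp [shiftFun, indicator]

lemma norm_shift_le (z : ℝ) (f : TimeL2) : ‖shift z f‖ ≤ ‖f‖ := by
  rw [shift_eq_restrict]
  refine (norm_Lp_toLp_restrict_le (Ioi 0) _).trans_eq ?_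
  rw [Lp.norm_compMeasurePreserving, Lp.norm_toLp,
    eLpNorm_indicator_eq_eLpNorm_restrict measurableSet_Ioi, ← Lp.norm_def]

/-- Strong continuity of the translation semigroup. -/
lemma continuous_shift (f : TimeL2) : Continuous fun z => shift (max z 0) f := by
  have h : ∀ z : ℝ, shift (max z 0) f = LpToLpRestrictCLM ℝ ℝ ℝ volume 2 (Ioi 0)
      (Lp.compMeasurePreserving
        ((ContinuousMap.mk (fun p : ℝ × ℝ => p.2 - max p.1 0) (by fun_prop)).curry z)
        (measurePreserving_sub_right volume (max z 0))
        (((memLp_indicator_iff_restrict measurableSet_Ioi).2 (Lp.memLp f)).toLp _)) :=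
    fun z => shift_eq_restrict (max z 0) f
  simp only [h]
  refine (LpToLpRestrictCLM ℝ ℝ ℝ volume 2 (Ioi 0)).continuous.comp ?_
  exact Continuous.compMeasurePreservingLp continuous_const (ContinuousMap.continuous _)
    (fun z => measurePreserving_sub_right volume (max z 0)) (by simp)

/-! ### Convolution operators -/

lemma aestronglyMeasurable_shift (f : TimeL2) (ν : Measure ℝ) :
    AEStronglyMeasurable (fun z => shift z f) (ν.restrict (Ioi 0)) := by
  refine (continuous_shift f).aestronglyMeasurable.congr ?_
  filter_upwards [ae_restrict_mem measurableSet_Ioi] with z hz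
  rw [max_eq_left (le_of_lt hz)]

lemma integrable_smul_shift {k : ℝ → ℝ} (hk : IntegrableOn k (Ioi 0)) (f : TimeL2) :
    IntegrableOn (fun z => k z • shift z f) (Ioi 0) := by
  refine (hk.norm.mul_const ‖f‖).mono'
    (hk.aestronglyMeasurable.smul (aestronglyMeasurable_shift f volume)) (ae_of_all _ fun z => ?_)
  rw [norm_smul]
  exact mul_le_mul_of_nonneg_left (norm_shift_le z f) (norm_nonneg _)

/-- The convolution of `f ∈ L²(0, ∞)` with an integrable kernel `k` on `(0, ∞)`, as the
superposition `∫_0^∞ k(z) f(· - z) dz` of translates. -/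
def conv (k : ℝ → ℝ) (f : TimeL2) : TimeL2 := ∫ z in Ioi (0 : ℝ), k z • shift z f

lemma laplace_conv {k : ℝ → ℝ} (hk : IntegrableOn k (Ioi 0)) (f : TimeL2) (ξ : Ioi (0 : ℝ)) :
    laplace ξ (conv k f) = (∫ z in Ioi (0 : ℝ), Real.exp (-(ξ * z)) * k z) * laplace ξ f := by
  rw [conv, ← ContinuousLinearMap.integral_comp_comm _ (integrable_smul_shift hk f),
    ← integral_mul_const]
  refine setIntegral_congr_fun measurableSet_Ioi fun z hz => ?_
  simp only [map_smul, laplace_shift ξ (le_of_lt hz), smul_eq_mul]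
  ring

lemma norm_conv_le {k : ℝ → ℝ} (hk : IntegrableOn k (Ioi 0)) (f : TimeL2) :
    ‖conv k f‖ ≤ (∫ z in Ioi (0 : ℝ), ‖k z‖) * ‖f‖ := by
  rw [conv, ← integral_mul_const]
  refine norm_integral_le_of_norm_le (hk.norm.mul_const ‖f‖) (ae_of_all _ fun z => ?_)
  rw [norm_smul]
  exact mul_le_mul_of_nonneg_left (norm_shift_le z f) (norm_nonneg _)

/-- Convolution with an integrable kernel as a bounded operator on `L²(0, ∞)`. -/
def convCLM (k : ℝ → ℝ) (hk : IntegrableOn k (Ioi 0)) : TimeL2 →L[ℝ] TimeL2 :=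
  LinearMap.mkContinuous
    { toFun := conv k
      map_add' := fun f g => laplace_ext fun ξ => by simp only [map_add, laplace_conv hk, mul_add]
      map_smul' := fun c f => laplace_ext fun ξ => by
        simp only [map_smul, laplace_conv hk, smul_eq_mul, RingHom.id_apply]; ring }
    (∫ z in Ioi (0 : ℝ), ‖k z‖) (norm_conv_le hk)

lemma convCLM_apply (k : ℝ → ℝ) (hk : IntegrableOn k (Ioi 0)) (f : TimeL2) :
    convCLM k hk f = ∫ z in Ioi (0 : ℝ), k z • shift z f := rfl

lemma stronglyMeasurable_conv {k : ℝ → ℝ → ℝ} (hk : Measurable (Function.uncurry k))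
    (f : TimeL2) : StronglyMeasurable fun l => conv (k l) f := by
  have h : StronglyMeasurable (Function.uncurry fun l z => k l z • shift (max z 0) f) :=
    hk.stronglyMeasurable.smul
      ((continuous_shift f).stronglyMeasurable.comp_measurable measurable_snd)
  convert h.integral_prod_right (ν := volume.restrict (Ioi (0 : ℝ))) using 2 with l
  refine setIntegral_congr_fun measurableSet_Ioi fun z hz => ?_
  simp only [max_eq_left (le_of_lt (mem_Ioi.1 hz))]

/-! ### Laplace integrals of power functions and the Marchaud kernel -/

/-- Tonelli's theorem for a nonnegative function `F` on `s × t` with inner integrals `A` and `B`: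
integrability is checked in the first order of integration and carried over to the other one. -/
lemma integrable_prod_and_swap {s t : Set ℝ} (hs : MeasurableSet s) (ht : MeasurableSet t)
    {F : ℝ → ℝ → ℝ} {A B : ℝ → ℝ} (hF : Measurable (Function.uncurry F))
    (h0 : ∀ x ∈ s, ∀ y ∈ t, 0 ≤ F x y) (hi : ∀ x ∈ s, IntegrableOn (F x) t)
    (hA : ∀ x ∈ s, ∫ y in t, F x y = A x) (hAi : IntegrableOn A s)
    (hB : ∀ y ∈ t, ∫ x in s, F x y = B y) :
    Integrable (Function.uncurry F) ((volume.restrict s).prod (volume.restrict t)) ∧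
      IntegrableOn B t ∧ ∫ y in t, B y = ∫ x in s, A x := by
  have hprod : Integrable (Function.uncurry F)
      ((volume.restrict s).prod (volume.restrict t)) := by
    rw [integrable_prod_iff hF.aestronglyMeasurable]
    refine ⟨?_, hAi.congr ?_⟩
    · filter_upwards [ae_restrict_mem hs] with x hx using hi x hx
    · filter_upwards [ae_restrict_mem hs] with x hx
      rw [← hA x hx]
      refine setIntegral_congr_fun ht fun y hy => ?_
      exact (Real.norm_of_nonneg (h0 x hx y hy)).symm
  refine ⟨hprod, hprod.integral_prod_right.congr ?_, ?_⟩
  · filter_upwards [ae_restrict_mem ht] with y hy using hB y hy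
  · rw [← setIntegral_congr_fun ht hB, ← setIntegral_congr_fun hs hA]
    exact (integral_integral_swap hprod).symm

lemma integrableOn_rpow_mul_exp_neg {b l : ℝ} (hb : 0 < b) (hl : 0 < l) :
    IntegrableOn (fun s : ℝ => s ^ (b - 1) * Real.exp (-(s * l))) (Ioi 0) := by
  have h := integrableOn_rpow_mul_exp_neg_mul_rpow (s := b - 1) (by linarith) one_pos hl
  simpa [mul_comm l] using h

lemma integral_rpow_mul_exp_neg {b l : ℝ} (hb : 0 < b) (hl : 0 < l) :
    ∫ s in Ioi (0 : ℝ), s ^ (b - 1) * Real.exp (-(s * l)) = Real.Gamma b * l ^ (-b) := by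
  have h := Real.integral_rpow_mul_exp_neg_mul_Ioi hb hl
  rw [one_div, Real.inv_rpow hl.le, ← Real.rpow_neg hl.le] at h
  simpa only [mul_comm l, mul_comm (Real.Gamma b)] using h

/-- The Beta integral behind the Balakrishnan-Komatsu formula, for the multiplier `a`. -/
lemma integral_rpow_mul_add_rpow_neg {n b a : ℝ} (hb : 0 < b) (hbn : b < n) (ha : 0 < a) :
    IntegrableOn (fun l : ℝ => l ^ (n - b - 1) * (l + a) ^ (-n)) (Ioi 0) ∧
    Real.Gamma n / (Real.Gamma b * Real.Gamma (n - b)) *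
      ∫ l in Ioi (0 : ℝ), l ^ (n - b - 1) * (l + a) ^ (-n) = a ^ (-b) := by
  have hn : 0 < n := hb.trans hbn
  have hnb : 0 < n - b := sub_pos.2 hbn
  -- Tonelli for `l^(n-b-1) s^(n-1) e^(-s(l+a))`.
  obtain ⟨-, hi, he⟩ := integrable_prod_and_swap (s := Ioi 0) (t := Ioi 0) measurableSet_Ioi
    measurableSet_Ioi
    (F := fun s l : ℝ => s ^ (n - 1) * Real.exp (-(s * a)) *
      (l ^ (n - b - 1) * Real.exp (-(l * s))))
    (A := fun s => Real.Gamma (n - b) * (s ^ (b - 1) * Real.exp (-(s * a))))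
    (B := fun l => Real.Gamma n * (l ^ (n - b - 1) * (l + a) ^ (-n))) (by fun_prop)
    (fun s hs l hl => by
      have := mem_Ioi.1 hs; have := mem_Ioi.1 hl; positivity)
    (fun s hs => (integrableOn_rpow_mul_exp_neg hnb hs).const_mul _)
    (fun s hs => by
      have hs := mem_Ioi.1 hs
      rw [integral_const_mul, integral_rpow_mul_exp_neg hnb hs,
        show b - 1 = (n - 1) + -(n - b) by ring, Real.rpow_add hs]
      ring)
    ((integrableOn_rpow_mul_exp_neg hb ha).const_mul _)
    (fun l hl => by
      have hl := mem_Ioi.1 hl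
      rw [mul_left_comm, ← integral_rpow_mul_exp_neg hn (add_pos hl ha), ← integral_const_mul]
      refine setIntegral_congr_fun measurableSet_Ioi fun s _ => ?_
      have hexp : Real.exp (-(s * (l + a))) = Real.exp (-(s * a)) * Real.exp (-(l * s)) := by
        rw [← Real.exp_add]; congr 1; ring
      simp only [hexp]
      ring)
  rw [integral_const_mul, integral_const_mul, integral_rpow_mul_exp_neg hb ha] at he
  have hG := (Real.Gamma_pos_of_pos hn).ne'
  refine ⟨(integrable_const_mul_iff (IsUnit.mk0 _ hG) _).1 hi, ?_⟩
  have h1 := (Real.Gamma_pos_of_pos hb).ne'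
  have h2 := (Real.Gamma_pos_of_pos hnb).ne'
  rw [div_mul_eq_mul_div, he]
  field_simp

lemma integral_rpow_mul_one_sub_exp {α : ℝ} (hα0 : 0 < α) (hα1 : α < 1) :
    IntegrableOn (fun x : ℝ => x ^ (-(α + 1)) * (1 - Real.exp (-x))) (Ioi 0) ∧
    ∫ x in Ioi (0 : ℝ), x ^ (-(α + 1)) * (1 - Real.exp (-x)) = Real.Gamma (1 - α) / α := by
  -- Tonelli for `x^(-α-1) e^(-y)` on the region `0 < y < x`.
  have hmeas : MeasurableSet {p : ℝ × ℝ | p.1 < p.2} :=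
    measurableSet_lt measurable_fst measurable_snd
  obtain ⟨-, hi, he⟩ := integrable_prod_and_swap (s := Ioi 0) (t := Ioi 0) measurableSet_Ioi
    measurableSet_Ioi
    (F := fun y x : ℝ => (Ioi y).indicator (fun x => Real.exp (-y) * x ^ (-(α + 1))) x)
    (A := fun y => α⁻¹ * (y ^ ((1 - α) - 1) * Real.exp (-(y * 1))))
    (B := fun x => x ^ (-(α + 1)) * (1 - Real.exp (-x)))
    ((by fun_prop : Measurable fun p : ℝ × ℝ =>
      Real.exp (-p.1) * p.2 ^ (-(α + 1))).indicator hmeas)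
    (fun y _ x hx => by
      have hx := mem_Ioi.1 hx
      exact indicator_apply_nonneg fun _ => by positivity)
    (fun y hy => by
      have hy := mem_Ioi.1 hy
      refine Integrable.integrableOn ?_
      rw [integrable_indicator_iff measurableSet_Ioi]
      exact (integrableOn_Ioi_rpow_of_lt (by linarith) hy).const_mul _)
    (fun y hy => by
      have hy := mem_Ioi.1 hy
      rw [setIntegral_indicator measurableSet_Ioi, Ioi_inter_Ioi, sup_eq_right.2 hy.le,
        integral_const_mul, integral_Ioi_rpow_of_lt (by linarith) hy,
        show -(α + 1) + 1 = -α by ring, show 1 - α - 1 = -α by ring, mul_one]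
      field_simp)
    ((integrableOn_rpow_mul_exp_neg (by linarith) one_pos).const_mul _)
    (fun x hx => by
      have hx := mem_Ioi.1 hx
      have h : ∀ y, (Ioi y).indicator (fun x => Real.exp (-y) * x ^ (-(α + 1))) x =
          (Iio x).indicator (fun y => Real.exp (-y) * x ^ (-(α + 1))) y := fun y => by
        simp only [indicator, mem_Ioi, mem_Iio]
      simp only [h]
      rw [setIntegral_indicator measurableSet_Iio, Ioi_inter_Iio, integral_mul_const,
        ← integral_Ioc_eq_integral_Ioo, ← intervalIntegral.integral_of_le hx.le,
        intervalIntegral.integral_comp_neg (fun y => Real.exp y), integral_exp]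
      simp
      ring)
  refine ⟨hi, he.trans ?_⟩
  rw [integral_const_mul, integral_rpow_mul_exp_neg (by linarith) one_pos]
  simp
  ring

/-- The kernel `(t_+^α - (t - 1)_+^α) / (Γ(α) Γ(1 - α) t)`, a probability density on `(0, ∞)`. The
Marchaud derivative truncated at `ε` is the convolution of the Marchaud derivative with the rescaled
kernel `ε⁻¹ k(t / ε)`. -/
def marchaudKernel (α t : ℝ) : ℝ :=
  (Real.Gamma α * Real.Gamma (1 - α))⁻¹ * ((t ^ α - (max (t - 1) 0) ^ α) / t)

lemma integral_exp_mul_rpow_sub {α : ℝ} (hα : 0 < α) {x : ℝ} (hx : 0 < x) :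
    IntegrableOn (fun t : ℝ => Real.exp (-(x * t)) * (t ^ α - (max (t - 1) 0) ^ α)) (Ioi 0) ∧
    ∫ t in Ioi (0 : ℝ), Real.exp (-(x * t)) * (t ^ α - (max (t - 1) 0) ^ α) =
      Real.Gamma (α + 1) * (x ^ (-(α + 1)) * (1 - Real.exp (-x))) := by
  have hi := integrableOn_rpow_mul_exp_neg (b := α + 1) (by linarith) hx
  have he := integral_rpow_mul_exp_neg (b := α + 1) (by linarith) hx
  rw [add_sub_cancel_right] at hi he
  set G : ℝ → ℝ := (Ioi 0).indicator fun s : ℝ => s ^ α * Real.exp (-(s * x)) with hG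
  have hGi : Integrable G := (integrable_indicator_iff measurableSet_Ioi).2 hi
  have hGe : ∫ t, G t = Real.Gamma (α + 1) * x ^ (-(α + 1)) := by
    rw [← he, hG, integral_indicator measurableSet_Ioi]
  have hpt : ∀ t ∈ Ioi (0 : ℝ), Real.exp (-(x * t)) * (t ^ α - (max (t - 1) 0) ^ α) =
      G t - Real.exp (-x) * G (t - 1) := fun t ht => by
    simp only [hG, indicator_of_mem ht, indicator, mem_Ioi, sub_pos]
    split_ifs with h1
    · rw [max_eq_left (by linarith), mul_left_comm (Real.exp (-x)), ← Real.exp_add,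
        show -x + -((t - 1) * x) = -(x * t) by ring, mul_comm t x]
      ring
    · rw [max_eq_right (by linarith), Real.zero_rpow hα.ne', mul_comm t x]
      ring
  have hGi' : Integrable fun t => Real.exp (-x) * G (t - 1) := (hGi.comp_sub_right 1).const_mul _
  have hrestr : ∫ t in Ioi (0 : ℝ), G (t - 1) = ∫ t, G t := by
    rw [← integral_sub_right_eq_self G 1]
    refine setIntegral_eq_integral_of_forall_compl_eq_zero fun t ht => ?_
    simp only [hG, indicator, mem_Ioi]
    rw [if_neg]
    simp only [mem_Ioi, not_lt] at ht
    linarith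
  have hrestr' : ∫ t in Ioi (0 : ℝ), G t = ∫ t, G t := by
    refine setIntegral_eq_integral_of_forall_compl_eq_zero fun t ht => ?_
    simp only [hG, indicator_of_notMem ht]
  refine ⟨(hGi.sub hGi').integrableOn.congr_fun (fun t ht => (hpt t ht).symm)
    measurableSet_Ioi, ?_⟩
  rw [setIntegral_congr_fun measurableSet_Ioi hpt, integral_sub hGi.integrableOn hGi'.integrableOn,
    integral_const_mul, hrestr, hrestr', hGe]
  ring

lemma rpow_sub_rpow_nonneg {α : ℝ} (hα : 0 < α) {t : ℝ} (ht : 0 < t) :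
    0 ≤ t ^ α - (max (t - 1) 0) ^ α :=
  sub_nonneg.2 <| Real.rpow_le_rpow (le_max_right _ _) (max_le (by linarith) ht.le) hα.le

/-- The Laplace transform of the Marchaud kernel, by Tonelli's theorem from
`e^(-η t) / t = ∫_η^∞ e^(-x t) dx`. -/
lemma integral_exp_mul_marchaudKernel {α : ℝ} (hα0 : 0 < α) (hα1 : α < 1) {η : ℝ} (hη : 0 ≤ η) :
    IntegrableOn (fun t => Real.exp (-(η * t)) * marchaudKernel α t) (Ioi 0) ∧
    ∫ t in Ioi (0 : ℝ), Real.exp (-(η * t)) * marchaudKernel α t =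
      α / Real.Gamma (1 - α) * ∫ x in Ioi η, x ^ (-(α + 1)) * (1 - Real.exp (-x)) := by
  have hpos : ∀ x ∈ Ioi η, 0 < x := fun x hx => hη.trans_lt hx
  have hΓ := Real.Gamma_pos_of_pos hα0
  have hΓ' := Real.Gamma_pos_of_pos (sub_pos.2 hα1)
  obtain ⟨-, hi, he⟩ := integrable_prod_and_swap (s := Ioi η) (t := Ioi 0) measurableSet_Ioi
    measurableSet_Ioi
    (F := fun x t : ℝ => Real.exp (-(x * t)) * (t ^ α - (max (t - 1) 0) ^ α))
    (A := fun x => Real.Gamma (α + 1) * (x ^ (-(α + 1)) * (1 - Real.exp (-x))))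
    (B := fun t => (Real.Gamma α * Real.Gamma (1 - α)) *
      (Real.exp (-(η * t)) * marchaudKernel α t)) (by fun_prop)
    (fun x _ t ht => mul_nonneg (Real.exp_pos _).le (rpow_sub_rpow_nonneg hα0 ht))
    (fun x hx => (integral_exp_mul_rpow_sub hα0 (hpos x hx)).1)
    (fun x hx => (integral_exp_mul_rpow_sub hα0 (hpos x hx)).2)
    (((integral_rpow_mul_one_sub_exp hα0 hα1).1.mono_set (Ioi_subset_Ioi hη)).const_mul _)
    (fun t ht => by
      have ht := mem_Ioi.1 ht
      have h := integral_exp_mul_Ioi (neg_lt_zero.2 ht) η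
      rw [integral_mul_const]
      simp only [show ∀ x : ℝ, -(x * t) = -t * x from fun x => by ring, h, marchaudKernel]
      field_simp)
  refine ⟨(integrable_const_mul_iff (IsUnit.mk0 _ (mul_pos hΓ hΓ').ne') _).1 hi, ?_⟩
  rw [integral_const_mul, integral_const_mul, Real.Gamma_add_one hα0.ne'] at he
  rw [div_mul_eq_mul_div, eq_div_iff hΓ'.ne']
  apply mul_left_cancel₀ hΓ.ne'
  linarith

lemma integrableOn_marchaudKernel {α : ℝ} (hα0 : 0 < α) (hα1 : α < 1) :
    IntegrableOn (marchaudKernel α) (Ioi 0) := by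
  simpa using (integral_exp_mul_marchaudKernel hα0 hα1 le_rfl).1

lemma integral_marchaudKernel {α : ℝ} (hα0 : 0 < α) (hα1 : α < 1) :
    ∫ t in Ioi (0 : ℝ), marchaudKernel α t = 1 := by
  have h := (integral_exp_mul_marchaudKernel hα0 hα1 le_rfl).2
  have hΓ' := (Real.Gamma_pos_of_pos (sub_pos.2 hα1)).ne'
  rw [(integral_rpow_mul_one_sub_exp hα0 hα1).2] at h
  simp only [zero_mul, neg_zero, Real.exp_zero, one_mul] at h
  rw [h]
  field_simp

/-- The multiplier of the Marchaud derivative truncated at `ε ≥ 0`. -/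
lemma marchaud_multiplier {α : ℝ} (hα0 : 0 < α) (hα1 : α < 1) {ξ ε : ℝ} (hξ : 0 < ξ) (hε : 0 ≤ ε) :
    IntegrableOn (fun w : ℝ => w ^ (-(α + 1)) * (1 - Real.exp (-(ξ * w)))) (Ioi ε) ∧
    α / Real.Gamma (1 - α) * ∫ w in Ioi ε, w ^ (-(α + 1)) * (1 - Real.exp (-(ξ * w))) =
      ξ ^ α * ∫ t in Ioi (0 : ℝ), Real.exp (-(ξ * ε * t)) * marchaudKernel α t := by
  have hξε : 0 ≤ ξ * ε := by positivity
  have hpt : ∀ w ∈ Ioi ε, ξ ^ (α + 1) * ((ξ * w) ^ (-(α + 1)) * (1 - Real.exp (-(ξ * w)))) =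
      w ^ (-(α + 1)) * (1 - Real.exp (-(ξ * w))) := fun w hw => by
    rw [Real.mul_rpow hξ.le (hε.trans (le_of_lt hw)), Real.rpow_neg hξ.le]
    field_simp
  constructor
  · refine IntegrableOn.congr_fun (Integrable.const_mul ?_ _) hpt measurableSet_Ioi
    have h := (integral_rpow_mul_one_sub_exp hα0 hα1).1.mono_set (Ioi_subset_Ioi hξε)
    exact (integrableOn_Ioi_comp_mul_left_iff
      (fun x => x ^ (-(α + 1)) * (1 - Real.exp (-x))) ε hξ).2 h
  · rw [(integral_exp_mul_marchaudKernel hα0 hα1 hξε).2,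
      ← setIntegral_congr_fun measurableSet_Ioi hpt,
      integral_const_mul, integral_comp_mul_left_Ioi (fun x => x ^ (-(α + 1)) * (1 - Real.exp (-x)))
      ε hξ, Real.rpow_add_one hξ.ne', smul_eq_mul]
    field_simp

/-! ### The Marchaud derivative as a Laplace multiplier -/

lemma integrableOn_smul_sub_shift {α : ℝ} (hα0 : 0 < α) {ε : ℝ} (hε : 0 < ε) (f : TimeL2) :
    IntegrableOn (fun w : ℝ => (w ^ (-(α + 1)) : ℝ) • (f - shift w f)) (Ioi ε) := by
  have hk := integrableOn_Ioi_rpow_of_lt (a := -(α + 1)) (by linarith) hε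
  refine (hk.norm.mul_const (‖f‖ + ‖f‖)).mono' (hk.aestronglyMeasurable.smul
    (aestronglyMeasurable_const.sub ((aestronglyMeasurable_shift f volume).mono_measure
      (Measure.restrict_mono (Ioi_subset_Ioi hε.le) le_rfl)))) (ae_of_all _ fun w => ?_)
  rw [norm_smul]
  exact mul_le_mul_of_nonneg_left
    ((norm_sub_le _ _).trans (add_le_add_right (norm_shift_le w f) _)) (norm_nonneg _)

lemma laplace_integral_sub_shift {α : ℝ} (hα0 : 0 < α) (hα1 : α < 1) {ε : ℝ} (hε : 0 ≤ ε)
    (f : TimeL2)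
    (hi : IntegrableOn (fun w : ℝ => (w ^ (-(α + 1)) : ℝ) • (f - shift w f)) (Ioi ε))
    (ξ : Ioi (0 : ℝ)) :
    laplace ξ ((α / Real.Gamma (1 - α)) •
      ∫ w in Ioi ε, (w ^ (-(α + 1)) : ℝ) • (f - shift w f)) =
    (∫ t in Ioi (0 : ℝ), Real.exp (-(ξ * ε * t)) * marchaudKernel α t) *
      ((ξ : ℝ) ^ α * laplace ξ f) := by
  rw [map_smul, ← ContinuousLinearMap.integral_comp_comm _ hi, smul_eq_mul, ← mul_assoc,
    mul_comm (integral _ _) ((ξ : ℝ) ^ α), ← (marchaud_multiplier hα0 hα1 ξ.2 hε).2, mul_assoc,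
    ← integral_mul_const]
  congr 1
  refine setIntegral_congr_fun measurableSet_Ioi fun w hw => ?_
  simp only [map_smul, map_sub, laplace_shift ξ (hε.trans (le_of_lt hw)), smul_eq_mul]
  ring

/-- The rescaled convolutions with an integrable kernel of integral `c` converge strongly to
multiplication by `c`. -/
lemma tendsto_integral_smul_shift {k : ℝ → ℝ} (hk : IntegrableOn k (Ioi 0)) (g : TimeL2) :
    Tendsto (fun ε : ℝ => ∫ t in Ioi (0 : ℝ), k t • shift (ε * t) g) (𝓝[>] 0)
      (𝓝 ((∫ t in Ioi (0 : ℝ), k t) • g)) := by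
  rw [← integral_smul_const]
  refine tendsto_integral_filter_of_dominated_convergence (fun t => ‖k t‖ * ‖g‖) ?_ ?_
    (hk.norm.mul_const _) ?_
  · filter_upwards [self_mem_nhdsWithin] with ε hε
    refine hk.aestronglyMeasurable.smul ?_
    refine ((continuous_shift g).comp (continuous_const_mul ε)).aestronglyMeasurable.congr ?_
    filter_upwards [ae_restrict_mem measurableSet_Ioi] with t ht
    simp only [Function.comp_apply, max_eq_left (mul_pos (mem_Ioi.1 hε) (mem_Ioi.1 ht)).le]
  · filter_upwards with ε
    filter_upwards with t
    rw [norm_smul]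
    exact mul_le_mul_of_nonneg_left (norm_shift_le _ g) (norm_nonneg _)
  · filter_upwards [ae_restrict_mem measurableSet_Ioi] with t ht
    have h : Tendsto (fun ε : ℝ => shift (max (ε * t) 0) g) (𝓝[>] 0) (𝓝 g) := by
      have h1 := ((continuous_shift g).comp (continuous_mul_const t)).tendsto 0
      simp only [Function.comp_apply, zero_mul, max_self, shift_zero] at h1
      exact h1.mono_left nhdsWithin_le_nhds
    refine (h.congr' ?_).const_smul (k t)
    filter_upwards [self_mem_nhdsWithin] with ε hε
    rw [max_eq_left (mul_pos (mem_Ioi.1 hε) (mem_Ioi.1 ht)).le]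

lemma laplace_integral_smul_shift {k : ℝ → ℝ} (hk : IntegrableOn k (Ioi 0)) (g : TimeL2)
    {ε : ℝ} (hε : 0 < ε) (ξ : Ioi (0 : ℝ)) :
    laplace ξ (∫ t in Ioi (0 : ℝ), k t • shift (ε * t) g) =
      (∫ t in Ioi (0 : ℝ), Real.exp (-(ξ * ε * t)) * k t) * laplace ξ g := by
  rw [← ContinuousLinearMap.integral_comp_comm, ← integral_mul_const]
  · refine setIntegral_congr_fun measurableSet_Ioi fun t ht => ?_
    simp only [map_smul, laplace_shift ξ (mul_pos hε (mem_Ioi.1 ht)).le, smul_eq_mul, mul_assoc]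
    ring
  · refine (hk.norm.mul_const ‖g‖).mono' (hk.aestronglyMeasurable.smul ?_) (ae_of_all _ fun t => ?_)
    · refine ((continuous_shift g).comp (continuous_const_mul ε)).aestronglyMeasurable.congr ?_
      filter_upwards [ae_restrict_mem measurableSet_Ioi] with t ht
      simp only [Function.comp_apply, max_eq_left (mul_pos hε (mem_Ioi.1 ht)).le]
    · rw [norm_smul]
      exact mul_le_mul_of_nonneg_left (norm_shift_le _ g) (norm_nonneg _)

/-- The Marchaud derivative is the Laplace multiplier `ξ^α`, on its maximal domain: the truncated
integrals of `f` are the convolutions of `g` with the rescaled Marchaud kernels. -/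
lemma hasLowerMarchaud_iff {α : ℝ} (hα0 : 0 < α) (hα1 : α < 1) {f g : TimeL2} :
    HasLowerMarchaud α f g ↔ ∀ ξ : Ioi (0 : ℝ), laplace ξ g = (ξ : ℝ) ^ α * laplace ξ f := by
  have hK := integrableOn_marchaudKernel hα0 hα1
  have hlim := fun g : TimeL2 => tendsto_integral_smul_shift hK g
  simp only [integral_marchaudKernel hα0 hα1, one_smul] at hlim
  constructor
  · intro h ξ
    have h1 := ((laplace ξ).continuous.tendsto g).comp h
    have h2 := (((laplace ξ).continuous.tendsto f).comp (hlim f)).const_mul ((ξ : ℝ) ^ α)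
    refine tendsto_nhds_unique h1 (h2.congr' ?_)
    filter_upwards [self_mem_nhdsWithin] with ε hε
    have hε := mem_Ioi.1 hε
    rw [Function.comp_apply, Function.comp_apply, laplace_integral_smul_shift hK f hε,
      laplace_integral_sub_shift hα0 hα1 hε.le f (integrableOn_smul_sub_shift hα0 hε f)]
    ring
  · intro h
    refine (hlim g).congr' ?_
    filter_upwards [self_mem_nhdsWithin] with ε hε
    have hε := mem_Ioi.1 hε
    refine laplace_ext fun ξ => ?_
    rw [laplace_integral_smul_shift hK g hε, h,
      laplace_integral_sub_shift hα0 hα1 hε.le f (integrableOn_smul_sub_shift hα0 hε f)]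

lemma addScalarGraph_shiftedMarchaud_iff {α μ l : ℝ} (hα0 : 0 < α) (hα1 : α < 1) {f g : TimeL2} :
    addScalarGraph (shiftedMarchaud α μ) l f g ↔
      ∀ ξ : Ioi (0 : ℝ), laplace ξ g = (l + (μ + (ξ : ℝ) ^ α)) * laplace ξ f := by
  rw [addScalarGraph, shiftedMarchaud, hasLowerMarchaud_iff hα0 hα1]
  refine forall_congr' fun ξ => ?_
  simp only [map_sub, map_smul, smul_eq_mul]
  constructor <;> intro h <;> linarith

/-! ### Smooth test functions -/

/-- Convolution with `e^(-t)` is the resolvent `(1 + d/dt)⁻¹`. -/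
lemma laplace_conv_exp (v : TimeL2) (ξ : Ioi (0 : ℝ)) :
    laplace ξ (conv (fun t => Real.exp (-t)) v) = (1 + (ξ : ℝ))⁻¹ * laplace ξ v := by
  have hξ := mem_Ioi.1 ξ.2
  rw [laplace_conv (integrableOn_exp_neg_Ioi 0)]
  congr 1
  have h := integral_exp_mul_Ioi (a := -(1 + ξ)) (by linarith) 0
  rw [mul_zero, Real.exp_zero, neg_div_neg_eq, one_div] at h
  rw [← h]
  refine setIntegral_congr_fun measurableSet_Ioi fun t _ => ?_
  simp only [← Real.exp_add]
  congr 1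
  ring

lemma norm_sub_shift_conv_exp_le (v : TimeL2) {w : ℝ} (hw : 0 ≤ w) :
    ‖conv (fun t => Real.exp (-t)) v - shift w (conv (fun t => Real.exp (-t)) v)‖ ≤
      w * (2 * ‖v‖) := by
  have hind : IntegrableOn ((Iic w).indicator fun _ : ℝ => (1 : ℝ)) (Ioi 0) := by
    rw [IntegrableOn, integrable_indicator_iff measurableSet_Iic, IntegrableOn,
      Measure.restrict_restrict measurableSet_Iic, inter_comm, Ioi_inter_Iic]
    exact integrableOn_const (by simp)
  have hinter : ∀ F : ℝ → ℝ, ∫ t in Ioi (0 : ℝ), (Iic w).indicator F t = ∫ t in (0)..w, F t :=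
    fun F => by
      rw [setIntegral_indicator measurableSet_Iic, Ioi_inter_Iic,
        intervalIntegral.integral_of_le hw]
  -- With `f = (1 + ∂)⁻¹ v` and `f' = v - f`, this is `f - f(· - w) = ∫_0^w f'(· - y) dy`.
  have hid : conv (fun t => Real.exp (-t)) v - shift w (conv (fun t => Real.exp (-t)) v) =
      conv ((Iic w).indicator fun _ => 1) (v - conv (fun t => Real.exp (-t)) v) := by
    refine laplace_ext fun ξ => ?_
    have hξ := mem_Ioi.1 ξ.2
    have hint : ∫ t in Ioi (0 : ℝ), Real.exp (-(ξ * t)) * (Iic w).indicator (fun _ => (1 : ℝ)) t =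
        (1 - Real.exp (-(ξ * w))) / ξ := by
      have h : ∀ t : ℝ, Real.exp (-(ξ * t)) * (Iic w).indicator (fun _ => (1 : ℝ)) t =
          (Iic w).indicator (fun t => Real.exp (-ξ * t)) t := fun t => by
        simp [indicator]
      simp only [h]
      rw [hinter, intervalIntegral.integral_comp_mul_left (fun t => Real.exp t) (by linarith),
        integral_exp, smul_eq_mul, mul_zero, Real.exp_zero, neg_mul]
      field_simp
      ring
    rw [laplace_conv hind, map_sub, map_sub, laplace_shift ξ hw, laplace_conv_exp, hint]
    field_simp
    ring
  have hone : ∫ t in Ioi (0 : ℝ), ‖(Iic w).indicator (fun _ => (1 : ℝ)) t‖ = w := by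
    simp only [norm_indicator_eq_indicator_norm, norm_one]
    rw [hinter]
    simp
  have hf : ‖conv (fun t => Real.exp (-t)) v‖ ≤ ‖v‖ := by
    refine (norm_conv_le (integrableOn_exp_neg_Ioi 0) v).trans_eq ?_
    simp only [Real.norm_eq_abs, Real.abs_exp]
    rw [integral_exp_neg_Ioi_zero, one_mul]
  rw [hid]
  refine (norm_conv_le hind _).trans ?_
  rw [hone]
  refine mul_le_mul_of_nonneg_left ((norm_sub_le _ _).trans ?_) hw
  linarith

/-- The multiplier `(μ + ξ^α) / (1 + ξ)` comes from an operator defined on all of `L²(0, ∞)`: the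
range of `(1 + d/dt)⁻¹` lies in the domain of the Marchaud derivative, because there the Marchaud
integral converges absolutely. -/
lemma exists_laplace_eq_div_mul {α : ℝ} (hα0 : 0 < α) (hα1 : α < 1) (μ : ℝ) (v : TimeL2) :
    ∃ v' : TimeL2, ∀ ξ : Ioi (0 : ℝ),
      laplace ξ v' = (μ + (ξ : ℝ) ^ α) / (1 + ξ) * laplace ξ v := by
  set f := conv (fun t => Real.exp (-t)) v with hf
  have hi : IntegrableOn (fun w : ℝ => (w ^ (-(α + 1)) : ℝ) • (f - shift w f)) (Ioi 0) := by
    refine (IntegrableOn.union ?_ (integrableOn_smul_sub_shift hα0 one_pos f)).mono_set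
      (Ioc_union_Ioi_eq_Ioi zero_le_one).ge
    have hb : IntegrableOn (fun w : ℝ => w ^ (-α) * (2 * ‖v‖)) (Ioc 0 1) :=
      ((intervalIntegrable_iff_integrableOn_Ioc_of_le zero_le_one).1
        (intervalIntegral.intervalIntegrable_rpow' (by linarith))).mul_const _
    refine hb.mono' (AEStronglyMeasurable.smul
      (by fun_prop : Measurable fun w : ℝ => w ^ (-(α + 1))).aestronglyMeasurable
      (aestronglyMeasurable_const.sub ((aestronglyMeasurable_shift f volume).mono_measure
        (Measure.restrict_mono Ioc_subset_Ioi_self le_rfl)))) ?_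
    filter_upwards [ae_restrict_mem measurableSet_Ioc] with w hw
    rw [norm_smul, Real.norm_of_nonneg (Real.rpow_nonneg hw.1.le _)]
    refine (mul_le_mul_of_nonneg_left (norm_sub_shift_conv_exp_le v hw.1.le)
      (Real.rpow_nonneg hw.1.le _)).trans_eq ?_
    rw [← mul_assoc, ← Real.rpow_add_one hw.1.ne', neg_add, neg_add_cancel_right]
  refine ⟨μ • f + (α / Real.Gamma (1 - α)) •
    ∫ w in Ioi (0 : ℝ), (w ^ (-(α + 1)) : ℝ) • (f - shift w f), fun ξ => ?_⟩
  rw [map_add, laplace_integral_sub_shift hα0 hα1 le_rfl f hi ξ]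
  simp only [mul_zero, zero_mul, neg_zero, Real.exp_zero, one_mul]
  rw [integral_marchaudKernel hα0 hα1, map_smul, hf, laplace_conv_exp, smul_eq_mul]
  field_simp

lemma integral_exp_mul_add_deriv {u : ℝ → ℝ} (hu : ContDiff ℝ ((⊤ : ℕ∞) : WithTop ℕ∞) u)
    (huc : HasCompactSupport u) (hus : tsupport u ⊆ Ioi 0) (ξ : ℝ) :
    ∫ t in Ioi (0 : ℝ), Real.exp (-(ξ * t)) * (u t + deriv u t) =
      (1 + ξ) * ∫ t in Ioi (0 : ℝ), Real.exp (-(ξ * t)) * u t := by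
  have hd : Continuous (deriv u) := hu.continuous_deriv (by simp)
  have hvan : ∀ t ∉ Ioi (0 : ℝ), u t = 0 := fun t ht =>
    image_eq_zero_of_notMem_tsupport fun h => ht (hus h)
  have hvan' : ∀ t ∉ Ioi (0 : ℝ), deriv u t = 0 := fun t ht =>
    image_eq_zero_of_notMem_tsupport fun h => ht (hus (tsupport_deriv_subset h))
  rw [setIntegral_eq_integral_of_forall_compl_eq_zero fun t ht => by simp [hvan t ht, hvan' t ht],
    setIntegral_eq_integral_of_forall_compl_eq_zero fun t ht => by simp [hvan t ht]]
  have hi : Integrable fun t => Real.exp (-(ξ * t)) * u t :=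
    Continuous.integrable_of_hasCompactSupport (by have := hu.continuous; fun_prop) huc.mul_left
  have hi' : Integrable fun t => Real.exp (-(ξ * t)) * deriv u t :=
    Continuous.integrable_of_hasCompactSupport (by fun_prop) huc.deriv.mul_left
  have hparts := integral_mul_deriv_eq_deriv_mul_of_integrable
    (u := fun t => Real.exp (-(ξ * t))) (u' := fun t => Real.exp (-(ξ * t)) * (-ξ))
    (v := u) (v' := deriv u)
    (fun t _ => by
      have h := ((hasDerivAt_id t).const_mul ξ).neg.exp
      simpa using h)
    (fun t _ => (hu.differentiable (by simp) t).hasDerivAt) hi'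
    ((hi.const_mul (-ξ)).congr (ae_of_all _ fun t => by simp only [Pi.mul_apply]; ring)) hi
  simp only [mul_add]
  rw [integral_add hi hi', hparts, add_mul, one_mul, ← integral_const_mul, ← integral_neg]
  congr 1
  refine integral_congr_ae (ae_of_all _ fun t => ?_)
  ring

/-- Test functions lie in the domain of every power of `μ + D`. -/
lemma exists_laplace_eq_pow_mul {α : ℝ} (hα0 : 0 < α) (hα1 : α < 1) (μ : ℝ) (n : ℕ) :
    ∀ u : ℝ → ℝ, ContDiff ℝ ((⊤ : ℕ∞) : WithTop ℕ∞) u → HasCompactSupport u → tsupport u ⊆ Ioi 0 →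
      ∃ v : TimeL2, ∀ ξ : Ioi (0 : ℝ), laplace ξ v =
        (μ + (ξ : ℝ) ^ α) ^ n * ∫ t in Ioi (0 : ℝ), Real.exp (-(ξ * t)) * u t := by
  induction n with
  | zero =>
    intro u hu huc _
    have hm : MemLp u 2 (volume.restrict (Ioi (0 : ℝ))) :=
      (hu.continuous.memLp_of_hasCompactSupport huc).restrict _
    exact ⟨hm.toLp u, fun ξ => by rw [laplace_toLp, pow_zero, one_mul]⟩
  | succ n ih =>
    intro u hu huc hus
    have hd : ContDiff ℝ ((⊤ : ℕ∞) : WithTop ℕ∞) (deriv u) :=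
      (contDiff_infty_iff_deriv.1 hu).2
    obtain ⟨v, hv⟩ := ih (fun t => u t + deriv u t) (hu.add hd) (huc.add huc.deriv)
      ((tsupport_add u (deriv u)).trans
        (union_subset hus ((tsupport_deriv_subset).trans hus)))
    obtain ⟨v', hv'⟩ := exists_laplace_eq_div_mul hα0 hα1 μ v
    refine ⟨v', fun ξ => ?_⟩
    have hξ := mem_Ioi.1 ξ.2
    rw [hv', hv, integral_exp_mul_add_deriv hu huc hus]
    field_simp
    ring

/-! ### The stable density and the fractional powers -/

/-- The density `z ↦ Γ(b)⁻¹ ∫_0^∞ s^(b - 1) e^(-s l) h(z, s) ds`; convolution with it is the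
operator `(l + D)^(-b)`. -/
def stableKernel (h : ℝ → ℝ → ℝ) (b l z : ℝ) : ℝ :=
  (Real.Gamma b)⁻¹ * ∫ s in Ioi (0 : ℝ), s ^ (b - 1) * Real.exp (-(s * l)) * h z s

section StableDensity

variable {α : ℝ} {h : ℝ → ℝ → ℝ}

lemma IsStableDensity.integrableOn (hh : IsStableDensity α h) {s ξ : ℝ} (hs : 0 < s)
    (hξ : 0 ≤ ξ) : IntegrableOn (fun z => Real.exp (-(ξ * z)) * h z s) (Ioi 0) := by
  by_contra hn
  have h1 := hh.laplace s ξ hs hξ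
  rw [integral_undef hn] at h1
  exact (Real.exp_pos _).ne h1

lemma IsStableDensity.laplace_kernel (hh : IsStableDensity α h) {b l ξ : ℝ} (hb : 0 < b)
    (hl : 0 < l) (hξ : 0 ≤ ξ) :
    Integrable (fun p : ℝ × ℝ => p.2 ^ (b - 1) * Real.exp (-(p.2 * l)) *
      (Real.exp (-(ξ * p.1)) * h p.1 p.2))
      ((volume.restrict (Ioi 0)).prod (volume.restrict (Ioi 0))) ∧
    IntegrableOn (fun z => Real.exp (-(ξ * z)) * stableKernel h b l z) (Ioi 0) ∧
    ∫ z in Ioi (0 : ℝ), Real.exp (-(ξ * z)) * stableKernel h b l z = (l + ξ ^ α) ^ (-b) := by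
  have hpos : 0 < l + ξ ^ α := add_pos_of_pos_of_nonneg hl (Real.rpow_nonneg hξ α)
  have hΓ := (Real.Gamma_pos_of_pos hb).ne'
  have hm : Measurable fun p : ℝ × ℝ => h p.2 p.1 := hh.measurable.comp measurable_swap
  obtain ⟨hp, hi, he⟩ := integrable_prod_and_swap (s := Ioi 0) (t := Ioi 0) measurableSet_Ioi
    measurableSet_Ioi
    (F := fun s z : ℝ => s ^ (b - 1) * Real.exp (-(s * l)) * (Real.exp (-(ξ * z)) * h z s))
    (A := fun s => s ^ (b - 1) * Real.exp (-(s * (l + ξ ^ α))))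
    (B := fun z => Real.Gamma b * (Real.exp (-(ξ * z)) * stableKernel h b l z))
    (Measurable.mul (by fun_prop) (Measurable.mul (by fun_prop) hm))
    (fun s hs z hz => by
      have h1 := hh.nonneg z s hz hs
      have := mem_Ioi.1 hs
      positivity)
    (fun s hs => (hh.integrableOn hs hξ).const_mul _)
    (fun s hs => by
      rw [integral_const_mul, hh.laplace s ξ hs hξ, mul_assoc, ← Real.exp_add]
      ring_nf)
    (integrableOn_rpow_mul_exp_neg hb hpos)
    (fun z _ => by
      rw [stableKernel, mul_left_comm, mul_inv_cancel_left₀ hΓ, ← integral_const_mul]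
      refine setIntegral_congr_fun measurableSet_Ioi fun s _ => ?_
      ring)
  refine ⟨hp.swap, (integrable_const_mul_iff (IsUnit.mk0 _ hΓ) _).1 hi, ?_⟩
  rw [integral_const_mul, integral_rpow_mul_exp_neg hb hpos] at he
  exact mul_left_cancel₀ hΓ he

lemma IsStableDensity.integrableOn_kernel (hh : IsStableDensity α h) {b l : ℝ} (hb : 0 < b)
    (hl : 0 < l) : IntegrableOn (stableKernel h b l) (Ioi 0) := by
  simpa using (hh.laplace_kernel hb hl le_rfl).2.1

lemma laplace_conv_stableKernel (hh : IsStableDensity α h) {b l : ℝ} (hb : 0 < b)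
    (hl : 0 < l) (f : TimeL2) (ξ : Ioi (0 : ℝ)) :
    laplace ξ (conv (stableKernel h b l) f) = (l + (ξ : ℝ) ^ α) ^ (-b) * laplace ξ f := by
  rw [laplace_conv (hh.integrableOn_kernel hb hl),
    (hh.laplace_kernel hb hl (le_of_lt ξ.2)).2.2]

lemma norm_conv_stableKernel_le (hh : IsStableDensity α h) (hα : α ≠ 0) {b l : ℝ} (hb : 0 < b)
    (hl : 0 < l) (f : TimeL2) : ‖conv (stableKernel h b l) f‖ ≤ l ^ (-b) * ‖f‖ := by
  refine (norm_conv_le (hh.integrableOn_kernel hb hl) f).trans_eq ?_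
  have h1 := (hh.laplace_kernel hb hl le_rfl).2.2
  simp only [zero_mul, neg_zero, Real.exp_zero, one_mul, Real.zero_rpow hα, add_zero] at h1
  rw [← h1]
  congr 1
  refine setIntegral_congr_fun measurableSet_Ioi fun z hz => Real.norm_of_nonneg ?_
  refine mul_nonneg (inv_nonneg.2 (Real.Gamma_pos_of_pos hb).le)
    (setIntegral_nonneg measurableSet_Ioi fun s hs => ?_)
  have h2 := hh.nonneg z s hz hs
  have := mem_Ioi.1 hs
  positivity

lemma IsStableDensity.measurable_kernel (hh : IsStableDensity α h) (b μ : ℝ) :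
    Measurable (Function.uncurry fun l z => stableKernel h b (l + μ) z) := by
  have hm : Measurable fun p : (ℝ × ℝ) × ℝ => h p.1.2 p.2 :=
    hh.measurable.comp ((measurable_snd.comp measurable_fst).prodMk measurable_snd)
  have hF : StronglyMeasurable fun p : (ℝ × ℝ) × ℝ =>
      p.2 ^ (b - 1) * Real.exp (-(p.2 * (p.1.1 + μ))) * h p.1.2 p.2 :=
    (Measurable.mul (by fun_prop) hm).stronglyMeasurable
  exact (hF.integral_prod_right' (ν := volume.restrict (Ioi (0 : ℝ)))).measurable.const_mul _

/-- The powers of `l + μ + D` are the Laplace multipliers `(l + μ + ξ^α)^n`, on their maximal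
domains. -/
lemma iterGraph_iff (hh : IsStableDensity α h) (hα0 : 0 < α) (hα1 : α < 1) {μ l : ℝ}
    (hl : 0 < l + μ) (n : ℕ) {f g : TimeL2} :
    IterGraph (addScalarGraph (shiftedMarchaud α μ) l) n f g ↔
      ∀ ξ : Ioi (0 : ℝ), laplace ξ g = (l + μ + (ξ : ℝ) ^ α) ^ n * laplace ξ f := by
  induction n generalizing f with
  | zero =>
    simp only [IterGraph, pow_zero, one_mul]
    exact ⟨fun h ξ => by rw [h], fun h => laplace_ext fun ξ => (h ξ).symm⟩
  | succ n ih =>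
    simp only [IterGraph, ih, addScalarGraph_shiftedMarchaud_iff hα0 hα1, ← add_assoc]
    constructor
    · rintro ⟨u, hu, hg⟩ ξ
      rw [hg, hu, pow_succ, mul_assoc]
    · intro hg
      rcases Nat.eq_zero_or_pos n with rfl | hn
      · exact ⟨g, fun ξ => by simpa using hg ξ, fun ξ => by simp⟩
      · have hpos : ∀ ξ : Ioi (0 : ℝ), 0 < l + μ + (ξ : ℝ) ^ α := fun ξ =>
          add_pos hl (Real.rpow_pos_of_pos ξ.2 α)
        have hu := laplace_conv_stableKernel hh (b := n) (Nat.cast_pos.2 hn) hl g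
        refine ⟨conv (stableKernel h n (l + μ)) g, fun ξ => ?_, fun ξ => ?_⟩
        · have := (hpos ξ).ne'
          rw [hu, hg, Real.rpow_neg (hpos ξ).le, Real.rpow_natCast, pow_succ]
          field_simp
        · have := (hpos ξ).ne'
          rw [hu, Real.rpow_neg (hpos ξ).le, Real.rpow_natCast]
          field_simp

/-- The fractional power `(μ + D)^β` is the Laplace multiplier `(μ + ξ^α)^β`, on its maximal
domain. -/
lemma fracPow_iff (hh : IsStableDensity α h) (hα0 : 0 < α) (hα1 : α < 1) {β μ : ℝ}
    (hβ : 0 < β) (hμ : 0 < μ) {φ ψ : TimeL2} :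
    FracPow (shiftedMarchaud α μ) β φ ψ ↔
      ∀ ξ : Ioi (0 : ℝ), laplace ξ φ = (μ + (ξ : ℝ) ^ α) ^ (-β) * laplace ξ ψ := by
  have hβn : β < ((⌊β⌋₊ + 1 : ℕ) : ℝ) := by exact_mod_cast Nat.lt_floor_add_one β
  rw [FracPow]
  set n : ℕ := ⌊β⌋₊ + 1 with hn
  have hn0 : (0 : ℝ) < n := hβ.trans hβn
  have hpos : ∀ ξ : Ioi (0 : ℝ), 0 < μ + (ξ : ℝ) ^ α := fun ξ =>
    add_pos hμ (Real.rpow_pos_of_pos ξ.2 α)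
  have hlap : ∀ r : ℝ → TimeL2,
      (∀ l : ℝ, 0 < l → IterGraph (addScalarGraph (shiftedMarchaud α μ) l) n (r l) ψ) →
      IntegrableOn (fun l : ℝ => (l ^ ((n : ℝ) - β - 1) : ℝ) • r l) (Ioi 0) →
      ∀ ξ : Ioi (0 : ℝ), laplace ξ ((Real.Gamma n / (Real.Gamma β * Real.Gamma (n - β))) •
        ∫ l in Ioi (0 : ℝ), (l ^ ((n : ℝ) - β - 1) : ℝ) • r l) =
        (μ + (ξ : ℝ) ^ α) ^ (-β) * laplace ξ ψ := by
    intro r hr hri ξ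
    rw [map_smul, ← ContinuousLinearMap.integral_comp_comm _ hri, smul_eq_mul,
      ← (integral_rpow_mul_add_rpow_neg hβ hβn (hpos ξ)).2, mul_assoc, ← integral_mul_const]
    congr 1
    refine setIntegral_congr_fun measurableSet_Ioi fun l hl => ?_
    have hl := mem_Ioi.1 hl
    have hlpos : 0 < l + μ + (ξ : ℝ) ^ α := by have := hpos ξ; linarith
    have h1 := (iterGraph_iff hh hα0 hα1 (add_pos hl hμ) n).1 (hr l hl) ξ
    simp only [map_smul, smul_eq_mul, h1, ← add_assoc]
    rw [Real.rpow_neg hlpos.le, Real.rpow_natCast]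
    field_simp
  constructor
  · rintro ⟨r, hr, hri, rfl⟩ ξ
    exact hlap r hr hri ξ
  · intro hφ
    have hr : ∀ l : ℝ, 0 < l → IterGraph (addScalarGraph (shiftedMarchaud α μ) l) n
        (conv (stableKernel h n (l + μ)) ψ) ψ := fun l hl => by
      refine (iterGraph_iff hh hα0 hα1 (add_pos hl hμ) n).2 fun ξ => ?_
      have hlpos : 0 < l + μ + (ξ : ℝ) ^ α := by have := hpos ξ; linarith
      rw [laplace_conv_stableKernel hh hn0 (add_pos hl hμ), Real.rpow_neg hlpos.le, Real.rpow_natCast]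
      field_simp
    have hri : IntegrableOn (fun l : ℝ => (l ^ ((n : ℝ) - β - 1) : ℝ) •
        conv (stableKernel h n (l + μ)) ψ) (Ioi 0) := by
      refine ((integral_rpow_mul_add_rpow_neg hβ hβn hμ).1.mul_const ‖ψ‖).mono'
        ((by fun_prop : Measurable fun l : ℝ => l ^ ((n : ℝ) - β - 1)).aestronglyMeasurable.smul
          (stronglyMeasurable_conv (hh.measurable_kernel n μ) ψ).aestronglyMeasurable) ?_
      filter_upwards [ae_restrict_mem measurableSet_Ioi] with l hl
      have hl := mem_Ioi.1 hl
      rw [norm_smul, Real.norm_of_nonneg (Real.rpow_nonneg hl.le _), mul_assoc]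
      exact mul_le_mul_of_nonneg_left (norm_conv_stableKernel_le hh hα0.ne' hn0 (add_pos hl hμ) ψ)
        (Real.rpow_nonneg hl.le _)
    exact ⟨_, hr, hri, laplace_ext fun ξ => by rw [hlap _ hr hri, hφ]⟩

/-- The range of `(μ + D)^(-β)` contains the test functions: `u = (μ + D)^(-β) ψ` for
`ψ = (μ + D)^(-(n - β)) (μ + D)^n u`. -/
lemma exists_fracPow_testFunction (hh : IsStableDensity α h) (hα0 : 0 < α) (hα1 : α < 1) {β μ : ℝ}
    (hβ : 0 < β) (hμ : 0 < μ) {u : ℝ → ℝ} (hu : ContDiff ℝ ((⊤ : ℕ∞) : WithTop ℕ∞) u)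
    (huc : HasCompactSupport u) (hus : tsupport u ⊆ Ioi 0)
    (hm : MemLp u 2 ((volume : Measure ℝ).restrict (Ioi 0))) :
    ∃ ψ : TimeL2, FracPow (shiftedMarchaud α μ) β (hm.toLp u) ψ := by
  obtain ⟨n, hn⟩ := exists_nat_gt β
  obtain ⟨v, hv⟩ := exists_laplace_eq_pow_mul hα0 hα1 μ n u hu huc hus
  refine ⟨conv (stableKernel h (n - β) μ) v,
    (fracPow_iff hh hα0 hα1 hβ hμ).2 fun ξ => ?_⟩
  have hpos : 0 < μ + (ξ : ℝ) ^ α := add_pos hμ (Real.rpow_pos_of_pos ξ.2 α)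
  rw [laplace_conv_stableKernel hh (sub_pos.2 hn) hμ, hv, laplace_toLp, ← mul_assoc,
    ← Real.rpow_add hpos,
    ← mul_assoc, ← Real.rpow_natCast, ← Real.rpow_add hpos,
    show -β + -(↑n - β) + (n : ℝ) = 0 by ring, Real.rpow_zero, one_mul]

end StableDensity

/-! ### The subordinator at a gamma time -/

/-- The approximation `(⌊(n + 1) w⌋ + 1) / (n + 1)` of `w` from above. -/
def ceilApprox (n : ℕ) (w : ℝ≥0) : ℝ≥0 := (⌊((n : ℝ≥0) + 1) * w⌋₊ + 1) / (n + 1)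

lemma le_ceilApprox (n : ℕ) (w : ℝ≥0) : w ≤ ceilApprox n w := by
  rw [ceilApprox, le_div_iff₀ (by positivity), mul_comm]
  exact (Nat.lt_floor_add_one _).le

lemma tendsto_ceilApprox (w : ℝ≥0) : Tendsto (fun n => ceilApprox n w) atTop (𝓝[≥] w) := by
  refine tendsto_nhdsWithin_iff.2 ⟨?_, .of_forall fun n => le_ceilApprox n w⟩
  rw [← NNReal.tendsto_coe]
  have hlim : Tendsto (fun n : ℕ => (w : ℝ) + 1 / ((n : ℝ) + 1)) atTop (𝓝 w) := by
    simpa using tendsto_one_div_add_atTop_nhds_zero_nat.const_add (w : ℝ)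
  refine tendsto_of_tendsto_of_tendsto_of_le_of_le tendsto_const_nhds hlim
    (fun n => NNReal.coe_le_coe.2 (le_ceilApprox n w)) fun n => ?_
  have h : ceilApprox n w ≤ w + 1 / (n + 1) := by
    rw [ceilApprox, add_div]
    gcongr
    rw [div_le_iff₀ (by positivity), mul_comm]
    exact Nat.floor_le (by positivity)
  exact_mod_cast h

lemma measurable_ceilApprox (n : ℕ) : Measurable (ceilApprox n) := by
  unfold ceilApprox
  fun_prop

/-- Evaluation of a path at the approximation of a time is jointly measurable in the time and the
path, since only countably many times occur. -/
lemma measurable_eval_ceilApprox (n : ℕ) :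
    Measurable fun p : ℝ≥0 × (ℝ≥0 → ℝ) => p.2 (ceilApprox n p.1) := by
  have h : Measurable fun p : ℕ × (ℝ≥0 → ℝ) => p.2 (((p.1 : ℝ≥0) + 1) / (n + 1)) :=
    measurable_from_prod_countable_right fun k =>
      measurable_pi_apply (((k : ℝ≥0) + 1) / (n + 1))
  have hfloor : Measurable fun p : ℝ≥0 × (ℝ≥0 → ℝ) => (⌊((n : ℝ≥0) + 1) * p.1⌋₊, p.2) := by
    fun_prop
  exact h.comp hfloor

section Subordinator

variable {Ω' : Type*} [MeasurableSpace Ω'] {P' : Measure Ω'} {α : ℝ} {H : ℝ≥0 → Ω' → ℝ}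

lemma IsStableSubordinator.nonneg (hH : IsStableSubordinator P' α H) (s : ℝ≥0) (ω : Ω') :
    0 ≤ H s ω :=
  (hH.zero ω).ge.trans (hH.mono ω zero_le)

lemma IsStableSubordinator.tendsto_ceilApprox (hH : IsStableSubordinator P' α H) (w : ℝ≥0)
    (ω : Ω') : Tendsto (fun n => H (ceilApprox n w) ω) atTop (𝓝 (H w ω)) :=
  (hH.rightCts ω w).tendsto.comp (_root_.tendsto_ceilApprox w)

lemma IsStableSubordinator.measurable_path (hH : IsStableSubordinator P' α H) :
    Measurable fun ω s => H s ω :=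
  measurable_pi_lambda _ hH.measurable

lemma IsStableSubordinator.measurable_eval_ceilApprox (hH : IsStableSubordinator P' α H)
    {W : Ω' → ℝ≥0} (hW : Measurable W) (n : ℕ) : Measurable fun ω => H (ceilApprox n (W ω)) ω :=
  (_root_.measurable_eval_ceilApprox n).comp (hW.prodMk hH.measurable_path)

lemma IsStableSubordinator.measurable_eval (hH : IsStableSubordinator P' α H) {W : Ω' → ℝ≥0}
    (hW : Measurable W) : Measurable fun ω => H (W ω) ω :=
  measurable_of_tendsto_metrizable (hH.measurable_eval_ceilApprox hW)
    (tendsto_pi_nhds.2 fun ω => hH.tendsto_ceilApprox (W ω) ω)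

variable [IsProbabilityMeasure P']

/-- Conditioning on an independent time: `𝔼 e^(-ξ H(W)) = 𝔼 e^(-ξ^α W)`. -/
lemma IsStableSubordinator.laplace_eval (hH : IsStableSubordinator P' α H) {W : Ω' → ℝ≥0}
    (hW : Measurable W) (hind : IndepFun W (fun ω s => H s ω) P') {ξ : ℝ} (hξ : 0 ≤ ξ) :
    ∫ ω, Real.exp (-(ξ * H (W ω) ω)) ∂P' = ∫ ω, Real.exp (-((W ω : ℝ) * ξ ^ α)) ∂P' := by
  have happrox : ∀ n : ℕ, ∫ ω, Real.exp (-(ξ * H (ceilApprox n (W ω)) ω)) ∂P' =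
      ∫ ω, Real.exp (-((ceilApprox n (W ω) : ℝ) * ξ ^ α)) ∂P' := by
    intro n
    have hpath := hH.measurable_path
    have hmap := (indepFun_iff_map_prod_eq_prod_map_map hW.aemeasurable hpath.aemeasurable).1 hind
    set F : ℝ≥0 × (ℝ≥0 → ℝ) → ℝ := fun p => Real.exp (-(ξ * p.2 (ceilApprox n p.1))) with hF
    have hFm : Measurable F := by
      have := _root_.measurable_eval_ceilApprox n
      fun_prop
    have hpair : Measurable fun ω => (W ω, fun s => H s ω) := hW.prodMk hpath
    have hFi : Integrable F ((P'.map W).prod (P'.map fun ω s => H s ω)) := by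
      rw [← hmap, integrable_map_measure hFm.aestronglyMeasurable hpair.aemeasurable]
      refine Integrable.of_bound (hFm.comp hpair).aestronglyMeasurable 1 (ae_of_all _ fun ω => ?_)
      simp only [hF, Function.comp_apply, Real.norm_eq_abs, Real.abs_exp, Real.exp_le_one_iff,
        neg_nonpos]
      exact mul_nonneg hξ (hH.nonneg _ ω)
    calc _ = ∫ p, F p ∂(P'.map fun ω => (W ω, fun s => H s ω)) :=
          (integral_map hpair.aemeasurable hFm.aestronglyMeasurable).symm
      _ = ∫ w, ∫ q, F (w, q) ∂(P'.map fun ω s => H s ω) ∂(P'.map W) := by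
          rw [hmap, integral_prod _ hFi]
      _ = ∫ w, Real.exp (-((ceilApprox n w : ℝ) * ξ ^ α)) ∂(P'.map W) := by
          refine integral_congr_ae (ae_of_all _ fun w => ?_)
          have hFw : Measurable fun q => F (w, q) := hFm.comp measurable_prodMk_left
          exact (integral_map hpath.aemeasurable hFw.aestronglyMeasurable).trans
            (hH.laplace (ceilApprox n w) ξ hξ)
      _ = _ := by
          have := measurable_ceilApprox n
          exact integral_map hW.aemeasurable (by fun_prop)
  have h1 : Tendsto (fun n : ℕ => ∫ ω, Real.exp (-(ξ * H (ceilApprox n (W ω)) ω)) ∂P') atTop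
      (𝓝 (∫ ω, Real.exp (-(ξ * H (W ω) ω)) ∂P')) := by
    refine tendsto_integral_of_dominated_convergence (fun _ => 1) (fun n => ?_)
      (integrable_const _) (fun n => ae_of_all _ fun ω => ?_) (ae_of_all _ fun ω => ?_)
    · exact ((hH.measurable_eval_ceilApprox hW n).const_mul ξ).neg.exp.aestronglyMeasurable
    · simp only [Real.norm_eq_abs, Real.abs_exp, Real.exp_le_one_iff, neg_nonpos]
      exact mul_nonneg hξ (hH.nonneg _ ω)
    · exact (((hH.tendsto_ceilApprox (W ω) ω).const_mul ξ).neg).rexp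
  have h2 : Tendsto (fun n : ℕ => ∫ ω, Real.exp (-((ceilApprox n (W ω) : ℝ) * ξ ^ α)) ∂P') atTop
      (𝓝 (∫ ω, Real.exp (-((W ω : ℝ) * ξ ^ α)) ∂P')) := by
    refine tendsto_integral_of_dominated_convergence (fun _ => 1) (fun n => ?_)
      (integrable_const _) (fun n => ae_of_all _ fun ω => ?_) (ae_of_all _ fun ω => ?_)
    · exact (((measurable_ceilApprox n).comp hW).coe_nnreal_real.mul_const
        (ξ ^ α)).neg.exp.aestronglyMeasurable
    · simp only [Real.norm_eq_abs, Real.abs_exp, Real.exp_le_one_iff, neg_nonpos]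
      positivity
    · have h := (_root_.tendsto_ceilApprox (W ω)).mono_right nhdsWithin_le_nhds
      exact (((NNReal.tendsto_coe.2 h).mul_const (ξ ^ α)).neg).rexp
  exact tendsto_nhds_unique h1 (h2.congr fun n => (happrox n).symm)

end Subordinator

lemma integral_exp_gammaMeasure {β μ c : ℝ} (hβ : 0 < β) (hμ : 0 < μ) (hc : 0 ≤ c) :
    ∫ x, Real.exp (-(x * c)) ∂(gammaMeasure β μ) = μ ^ β * (μ + c) ^ (-β) := by
  have hΓ := (Real.Gamma_pos_of_pos hβ).ne'
  have hm : Measurable (gammaPDF β μ) := (measurable_gammaPDFReal β μ).ennreal_ofReal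
  rw [gammaMeasure, integral_withDensity_eq_integral_toReal_smul hm
    (ae_of_all _ fun _ => ENNReal.ofReal_lt_top)]
  have hpt : ∀ x : ℝ, x ≠ 0 → (gammaPDF β μ x).toReal • Real.exp (-(x * c)) =
      (Ioi (0 : ℝ)).indicator
        (fun x => μ ^ β / Real.Gamma β * (x ^ (β - 1) * Real.exp (-(x * (μ + c))))) x := by
    intro x hx
    rcases lt_or_gt_of_ne hx with hx | hx
    · rw [gammaPDF_of_neg hx, indicator_of_notMem (by simpa using hx.le)]
      simp
    · have hΓ' := Real.Gamma_pos_of_pos hβ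
      rw [gammaPDF_of_nonneg hx.le, ENNReal.toReal_ofReal (by positivity),
        indicator_of_mem (mem_Ioi.2 hx), smul_eq_mul, mul_add, neg_add, Real.exp_add, mul_comm μ x]
      ring
  have hae : ∀ᵐ x : ℝ, x ≠ 0 := by simp [ae_iff]
  rw [integral_congr_ae (hae.mono hpt), integral_indicator measurableSet_Ioi, integral_const_mul,
    integral_rpow_mul_exp_neg hβ (by linarith)]
  field_simp

end

/-! ### The solution process -/

theorem theorem2p1 {Ω : Type*} [MeasurableSpace Ω] (P : Measure Ω) [IsProbabilityMeasure P]
    (α β μ : ℝ) (hα0 : 0 < α) (hα1 : α < 1) (hβ : 0 < β) (hμ : 0 < μ)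
    (σ : ℝ≥0) (ℰ : GeneralizedProcess P) (hℰ : IsGaussianWhiteNoise σ ℰ)
    (h : ℝ → ℝ → ℝ) (hh : IsStableDensity α h) :
    ∃ X : GeneralizedProcess P,
      (∀ ψ : TimeL2,
        Integrable (fun p : ℝ × ℝ =>
            (p.2 ^ (β - 1) * Real.exp (-(p.2 * μ)) * h p.1 p.2) • ℰ (shift p.1 ψ))
          ((volume.restrict (Ioi 0)).prod (volume.restrict (Ioi 0))) ∧
        X ψ = (Real.Gamma β)⁻¹ • ∫ z in Ioi (0 : ℝ), ∫ s in Ioi (0 : ℝ),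
            (s ^ (β - 1) * Real.exp (-(s * μ)) * h z s) • ℰ (shift z ψ)) ∧
      IsWeakSolution α β μ X ℰ ∧
      ∀ {Ω' : Type*} [MeasurableSpace Ω'] (P' : Measure Ω') [IsProbabilityMeasure P']
        (H : ℝ≥0 → Ω' → ℝ) (W : Ω' → ℝ≥0), IsStableSubordinator P' α H → Measurable W →
        HasLaw (fun ω => (W ω : ℝ)) (gammaMeasure β μ) P' →
        IndepFun W (fun ω s => H s ω) P' →
        ∀ ψ : TimeL2,
          Integrable (fun ω => ℰ (shift (H (W ω) ω) ψ)) P' ∧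
          X ψ = (μ ^ (-β) : ℝ) • ∫ ω, ℰ (shift (H (W ω) ω) ψ) ∂P' := by
  have hk := hh.integrableOn_kernel hβ hμ
  have hlap := laplace_conv_stableKernel hh hβ hμ
  refine ⟨ℰ ∘L convCLM (stableKernel h β μ) hk, fun ψ => ⟨?_, ?_⟩, ⟨?_, ?_⟩, ?_⟩
  · have hi := (hh.laplace_kernel hβ hμ le_rfl).1
    simp only [zero_mul, neg_zero, Real.exp_zero, one_mul] at hi
    have hm : AEStronglyMeasurable (fun p : ℝ × ℝ => ℰ (shift p.1 ψ))
        ((volume.restrict (Ioi 0)).prod (volume.restrict (Ioi 0))) :=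
      ℰ.continuous.comp_aestronglyMeasurable (aestronglyMeasurable_shift ψ volume).comp_fst
    refine (hi.norm.mul_const (‖ℰ‖ * ‖ψ‖)).mono' (hi.aestronglyMeasurable.smul hm)
      (ae_of_all _ fun p => ?_)
    rw [norm_smul]
    exact mul_le_mul_of_nonneg_left (ℰ.le_opNorm_of_le (norm_shift_le p.1 ψ)) (norm_nonneg _)
  · rw [ContinuousLinearMap.comp_apply, convCLM_apply,
      ← ContinuousLinearMap.integral_comp_comm _ (integrable_smul_shift hk ψ), ← integral_smul]
    refine integral_congr_ae (ae_of_all _ fun z => ?_)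
    simp only [map_smul, stableKernel, integral_smul_const, smul_smul]
  · intro u hu huc hus hm
    exact exists_fracPow_testFunction hh hα0 hα1 hβ hμ hu huc hus hm
  · intro φ ψ hφ
    have hφ' := (fracPow_iff hh hα0 hα1 hβ hμ).1 hφ
    rw [ContinuousLinearMap.comp_apply]
    congr 1
    exact laplace_ext fun ξ => (hlap ψ ξ).trans (hφ' ξ).symm
  · intro Ω' _ P' _ H W hH hW hWlaw hind ψ
    have hmeas := hH.measurable_eval hW
    have hi : Integrable (fun ω => shift (H (W ω) ω) ψ) P' := by
      refine Integrable.of_bound ?_ ‖ψ‖ (ae_of_all _ fun ω => norm_shift_le _ ψ)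
      refine ((continuous_shift ψ).stronglyMeasurable.comp_measurable
        hmeas).aestronglyMeasurable.congr (ae_of_all _ fun ω => ?_)
      simp only [Function.comp_apply, max_eq_left (hH.nonneg (W ω) ω)]
    refine ⟨ℰ.integrable_comp hi, ?_⟩
    rw [ContinuousLinearMap.integral_comp_comm _ hi, ← map_smul, ContinuousLinearMap.comp_apply]
    congr 1
    refine laplace_ext fun ξ => ?_
    have hξ := mem_Ioi.1 ξ.2
    have hgamma : ∫ ω, Real.exp (-((W ω : ℝ) * (ξ : ℝ) ^ α)) ∂P' =
        μ ^ β * (μ + (ξ : ℝ) ^ α) ^ (-β) :=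
      (hWlaw.integral_comp (f := fun x => Real.exp (-(x * (ξ : ℝ) ^ α))) (by fun_prop)).trans
        (integral_exp_gammaMeasure hβ hμ (Real.rpow_nonneg hξ.le α))
    refine (hlap ψ ξ).trans ?_
    rw [map_smul, ← ContinuousLinearMap.integral_comp_comm _ hi]
    simp only [laplace_shift ξ (hH.nonneg _ _)]
    rw [integral_mul_const, hH.laplace_eval hW hind hξ.le, hgamma, smul_eq_mul,
      ← mul_assoc, ← mul_assoc, ← Real.rpow_add hμ, neg_add_cancel, Real.rpow_zero, one_mul]
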